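/- Let $N\ge 2$ and $n$ be natural numbers, let $\sigma$ be a permutation of $\{1,\dots,n\}$ and let $z_1,\dots,z_n$ be complex numbers of modulus one with $z_i^N=z_{\sigma(i)}$ for all $i$. On the Hilbert space $L^2(\mathbb{R})^n$ (the direct sum of $n$ copies of $L^2(\mathbb R)$) consider the unitary operators $$T(f_1,\dots,f_n)=(z_1T_0f_1,\dots,z_nT_0f_n),\qquad U(f_1,\dots,f_n)=(U_0f_{\sigma(1)},\dots,U_0f_{\sigma(n)}),$$ where $T_0f(x)=f(x-1)$ and $U_0f(x)=N^{-1/2}f(x/N)$. Let $(V_j)_{j\in\mathbb{Z}}$ be a generalized multiresolution analysis (GMRA), i.e. a family of linear subspaces of $L^2(\mathbb{R})^n$ with $V_j\subseteq V_{j+1}$ and $UV_j=V_{j-1}$ for all $j\in\mathbb{Z}$, with $\bigcup_jV_j$ dense in $L^2(\mathbb{R})^n$ and $\bigcap_jV_j=\{0\}$, and with $T^kV_0\subseteq V_0$ for all $k\in\mathbb{Z}$. Let $\Phi\subseteq V_0$ be a normalized tight frame (NTF) generator for $V_0$, i.e. $\sum_{\varphi\in\Phi}\sum_{k\in\mathbb{Z}}|\langle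 f,T^k\varphi\rangle|^2=\|f\|^2$ for all $f\in V_0$. Write $\varphi=(\varphi_1,\dots,\varphi_n)$ for $\varphi\in\Phi$, and let $\widehat{f}$ be the $L^2$ Fourier transform of $f\in L^2(\mathbb R)$ in the normalization $\widehat{f}(\xi)=\int_{\mathbb{R}}f(x)e^{-i\xi x}\,dx$. Then, for almost every $\xi\in\mathbb{R}$ and every $i\in\{1,\dots,n\}$, the sums $\sum_{\varphi\in\Phi}|\widehat{\varphi}_i|^2(\xi/N^m)$ are finite for all integers $m\ge 0$, and $$\lim_{m\to\infty}\sum_{\varphi\in\Phi}|\widehat{\varphi}_i|^2\left(\frac{\xi}{N^m}\right)=1.$$ -/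

import Mathlib

open MeasureTheory Filter Topology
open scoped FourierTransform SchwartzMap ENNReal

noncomputable section

namespace SuperWavelet

/-- The Hilbert space `L²(ℝ)` of complex-valued functions. -/
abbrev L2R : Type := Lp ℂ 2 (volume : Measure ℝ)

/-- The Hilbert space `L²(ℝ)ⁿ = L²(ℝ) ⊕ ... ⊕ L²(ℝ)` (`n` summands). -/
abbrev L2Rn (n : ℕ) : Type := PiLp 2 (fun _ : Fin n => L2R)

/-- The translation `(T₀ f)(x) = f (x - 1)` as a unitary operator of `L²(ℝ)`. -/
def T₀ : L2R ≃ₗᵢ[ℂ] L2R :=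
  LinearIsometryEquiv.ofSurjective
    (Lp.compMeasurePreservingₗᵢ ℂ (fun x : ℝ => x - 1) (measurePreserving_sub_right volume 1))
    (fun g => by
      refine ⟨Lp.compMeasurePreserving (fun x : ℝ => x + 1)
        (measurePreserving_add_right volume 1) g, ?_⟩
      apply Lp.ext
      have h1 := Lp.coeFn_compMeasurePreserving
        (Lp.compMeasurePreserving (fun x : ℝ => x + 1)
          (measurePreserving_add_right volume 1) g) (measurePreserving_sub_right volume (1 : ℝ))
      have h2 := (measurePreserving_sub_right volume (1 : ℝ)).quasiMeasurePreserving.ae_eq_comp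
        (Lp.coeFn_compMeasurePreserving g (measurePreserving_add_right volume (1 : ℝ)))
      refine h1.trans (h2.trans (Eventually.of_forall fun x => ?_))
      simp)

theorem T₀_coe (f : L2R) : T₀ f =ᵐ[volume] fun x : ℝ => f (x - 1) :=
  Lp.coeFn_compMeasurePreserving f (measurePreserving_sub_right volume (1 : ℝ))

theorem quasiMP_div {c : ℝ} (hc : 0 < c) :
    Measure.QuasiMeasurePreserving (fun x : ℝ => x / c) volume volume := by
  refine ⟨by fun_prop, ?_⟩
  have h := Real.map_volume_mul_right (a := c⁻¹) (inv_ne_zero hc.ne')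
  simp only [div_eq_mul_inv]
  rw [h]
  exact Measure.smul_absolutelyContinuous

theorem eLpNorm_dil {c : ℝ} (hc : 0 < c) (f : L2R) :
    eLpNorm (fun x : ℝ => ((Real.sqrt c)⁻¹ : ℂ) * f (x / c)) 2 volume = eLpNorm f 2 volume := by
  have hm : AEStronglyMeasurable (f : ℝ → ℂ) (Measure.map (fun x : ℝ => x / c) volume) :=
    (Lp.aestronglyMeasurable f).mono_ac (quasiMP_div hc).absolutelyContinuous
  have h1 := eLpNorm_map_measure (p := 2) hm (by fun_prop : AEMeasurable (fun x : ℝ => x / c) volume)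
  have h2 : Measure.map (fun x : ℝ => x / c) volume = ENNReal.ofReal c • volume := by
    have h := Real.map_volume_mul_right (a := c⁻¹) (inv_ne_zero hc.ne')
    simp only [div_eq_mul_inv]
    rw [h, inv_inv, abs_of_pos hc]
  rw [h2, eLpNorm_smul_measure_of_ne_top (by norm_num)] at h1
  have h3 := eLpNorm_const_smul ((Real.sqrt c)⁻¹ : ℂ) ((f : ℝ → ℂ) ∘ fun x : ℝ => x / c) 2
    (volume : Measure ℝ)
  have h4 : (fun x : ℝ => ((Real.sqrt c)⁻¹ : ℂ) * f (x / c))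
      = ((Real.sqrt c)⁻¹ : ℂ) • ((f : ℝ → ℂ) ∘ fun x : ℝ => x / c) := rfl
  rw [h4, h3, ← h1, smul_eq_mul, ← mul_assoc]
  have h5 : ‖((Real.sqrt c)⁻¹ : ℂ)‖ₑ * ENNReal.ofReal c ^ ((1 / 2 : ℝ≥0∞)).toReal = 1 := by
    have e : ‖((Real.sqrt c)⁻¹ : ℂ)‖ₑ = ENNReal.ofReal (Real.sqrt c)⁻¹ := by
      rw [← ofReal_norm, norm_inv, Complex.norm_real, Real.norm_of_nonneg (Real.sqrt_nonneg c)]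
    rw [e, ENNReal.ofReal_rpow_of_pos hc, ← ENNReal.ofReal_mul (by positivity)]
    have : c ^ ((1 / 2 : ℝ≥0∞)).toReal = Real.sqrt c := by
      rw [Real.sqrt_eq_rpow, ENNReal.toReal_div]; norm_num
    rw [this, inv_mul_cancel₀ (Real.sqrt_pos.2 hc).ne', ENNReal.ofReal_one]
  rw [h5, one_mul]

theorem memLp_dil {c : ℝ} (hc : 0 < c) (f : L2R) :
    MemLp (fun x : ℝ => ((Real.sqrt c)⁻¹ : ℂ) * f (x / c)) 2 volume :=
  ⟨((Lp.aestronglyMeasurable f).comp_quasiMeasurePreserving (quasiMP_div hc)).const_mul _,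
    by rw [eLpNorm_dil hc]; exact Lp.eLpNorm_lt_top f⟩

/-- The dilation by `c > 0` as a linear isometry of `L²(ℝ)`: `f ↦ c^{-1/2} f (x / c)`. -/
def dilIsometry {c : ℝ} (hc : 0 < c) : L2R →ₗᵢ[ℂ] L2R where
  toFun f := (memLp_dil hc f).toLp _
  map_add' f g := by
    rw [← MemLp.toLp_add]
    refine MemLp.toLp_congr _ _ ?_
    filter_upwards [(quasiMP_div hc).ae_eq_comp (Lp.coeFn_add f g)] with x hx
    simp only [Function.comp_apply, Pi.add_apply] at hx ⊢
    rw [hx, mul_add]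
  map_smul' a f := by
    rw [RingHom.id_apply, ← MemLp.toLp_const_smul]
    refine MemLp.toLp_congr _ _ ?_
    filter_upwards [(quasiMP_div hc).ae_eq_comp (Lp.coeFn_smul a f)] with x hx
    simp only [Function.comp_apply, Pi.smul_apply, smul_eq_mul] at hx ⊢
    rw [hx]; ring
  norm_map' f := by
    change ‖(memLp_dil hc f).toLp _‖ = ‖f‖
    rw [Lp.norm_toLp, eLpNorm_dil hc, Lp.norm_def]

theorem dilIsometry_coe {c : ℝ} (hc : 0 < c) (f : L2R) :
    dilIsometry hc f =ᵐ[volume] fun x : ℝ => ((Real.sqrt c)⁻¹ : ℂ) * f (x / c) :=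
  (memLp_dil hc f).coeFn_toLp

/-- The dilation `(U₀ f)(x) = N^{-1/2} f (x / N)` as a unitary operator of `L²(ℝ)`. -/
def U₀ (N : ℕ) (hN : 2 ≤ N) : L2R ≃ₗᵢ[ℂ] L2R :=
  have hc : (0 : ℝ) < N := by exact_mod_cast (by omega : 0 < N)
  LinearIsometryEquiv.ofSurjective (dilIsometry hc) (fun g => by
    refine ⟨dilIsometry (inv_pos.2 hc) g, ?_⟩
    apply Lp.ext
    refine (dilIsometry_coe hc _).trans ?_
    filter_upwards [(quasiMP_div hc).ae_eq_comp (dilIsometry_coe (inv_pos.2 hc) g)] with x hx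
    simp only [Function.comp_apply] at hx
    have hs : (Real.sqrt (N : ℝ) : ℂ) ≠ 0 := by
      exact_mod_cast (Real.sqrt_pos.2 hc).ne'
    rw [hx, Real.sqrt_inv, div_inv_eq_mul, div_mul_cancel₀ _ hc.ne']
    push_cast
    rw [inv_inv, ← mul_assoc, inv_mul_cancel₀ hs, one_mul])

theorem U₀_coe (N : ℕ) (hN : 2 ≤ N) (f : L2R) :
    U₀ N hN f =ᵐ[volume] fun x : ℝ => ((Real.sqrt N)⁻¹ : ℂ) * f (x / N) :=
  dilIsometry_coe (c := (N : ℝ)) (by exact_mod_cast (by omega : 0 < N)) f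

/-- Multiplication by a complex number of modulus one, as a unitary operator of `L²(ℝ)`. -/
def phase (z : Circle) : L2R ≃ₗᵢ[ℂ] L2R where
  toLinearEquiv := LinearEquiv.smulOfNeZero ℂ L2R (z : ℂ) z.coe_ne_zero
  norm_map' f := by
    change ‖(z : ℂ) • f‖ = ‖f‖
    rw [norm_smul, Circle.norm_coe, one_mul]

/-- The translation of the permutative wavelet representation,
`T (f₁, ..., fₙ) = (z₁ T₀ f₁, ..., zₙ T₀ fₙ)`. -/
def T {n : ℕ} (z : Fin n → Circle) : L2Rn n ≃ₗᵢ[ℂ] L2Rn n :=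
  LinearIsometryEquiv.piLpCongrRight 2 (fun i => T₀.trans (phase (z i)))

/-- The dilation of the permutative wavelet representation,
`U (f₁, ..., fₙ) = (U₀ f_{σ(1)}, ..., U₀ f_{σ(n)})`. -/
def U {n : ℕ} (N : ℕ) (hN : 2 ≤ N) (σ : Equiv.Perm (Fin n)) : L2Rn n ≃ₗᵢ[ℂ] L2Rn n :=
  (LinearIsometryEquiv.piLpCongrLeft 2 ℂ L2R σ.symm).trans
    (LinearIsometryEquiv.piLpCongrRight 2 (fun _ => U₀ N hN))

theorem T_apply {n : ℕ} (z : Fin n → Circle) (f : L2Rn n) (i : Fin n) :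
    T z f i = (z i : ℂ) • T₀ (f i) := rfl

theorem U_apply {n : ℕ} (N : ℕ) (hN : 2 ≤ N) (σ : Equiv.Perm (Fin n)) (f : L2Rn n) (i : Fin n) :
    U N hN σ f i = U₀ N hN (f (σ i)) := rfl

/-- A subspace of `L²(ℝ)ⁿ` is shift invariant if `T^k V ⊆ V` for all `k ∈ ℤ`. -/
def IsShiftInvariant {n : ℕ} (z : Fin n → Circle) (V : Submodule ℂ (L2Rn n)) : Prop :=
  ∀ k : ℤ, ∀ f ∈ V, (T z ^ k) f ∈ V

/-- Generalized multiresolution analysis of `L²(ℝ)ⁿ` for the affine structure `(U, T)`. -/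
structure IsGMRA {n : ℕ} (N : ℕ) (hN : 2 ≤ N) (σ : Equiv.Perm (Fin n)) (z : Fin n → Circle)
    (V : ℤ → Submodule ℂ (L2Rn n)) : Prop where
  le_succ : ∀ j : ℤ, V j ≤ V (j + 1)
  map_U : ∀ j : ℤ, (V j).map (U N hN σ).toLinearEquiv.toLinearMap = V (j - 1)
  dense_iUnion : Dense (⋃ j : ℤ, (V j : Set (L2Rn n)))
  iInf_eq_bot : ⨅ j : ℤ, V j = ⊥
  shiftInvariant : IsShiftInvariant z (V 0)

/-- A family `(eᵢ)` is a normalized tight frame for the subspace `V` if its members lie in `V`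
and `∑ᵢ |⟨f, eᵢ⟩|² = ‖f‖²` for all `f ∈ V`. -/
def IsNTF {n : ℕ} {ι : Type*} (e : ι → L2Rn n) (V : Submodule ℂ (L2Rn n)) : Prop :=
  (∀ i, e i ∈ V) ∧ ∀ f ∈ V, HasSum (fun i => ‖inner ℂ (e i) f‖ ^ 2) (‖f‖ ^ 2)

/-- A subset `Φ` of `V` is a normalized tight frame generator for the shift invariant subspace `V`
if the family `(T^k φ)`, indexed by the pairs `(k, φ) ∈ ℤ × Φ`, is a normalized tight frame
for `V`. -/
def IsNTFGenerator {n : ℕ} (z : Fin n → Circle) (Φ : Set (L2Rn n))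
    (V : Submodule ℂ (L2Rn n)) : Prop :=
  Φ ⊆ V ∧ IsNTF (fun p : ℤ × Φ => (T z ^ p.1) (p.2 : L2Rn n)) V

/-- The `L²` Fourier transform in the normalization `f̂ (ξ) = ∫ f(x) e^{-iξx} dx`,
obtained by rescaling Mathlib's unitary transform `𝓕 f (ξ) = ∫ f(x) e^{-2πiξx} dx`. -/
def hat (f : L2R) : ℝ → ℂ := fun ξ => (𝓕 f : L2R) (ξ / (2 * Real.pi))

/-- On Schwartz functions `hat` is the integral `∫ f(x) e^{-iξx} dx`. -/
theorem hat_schwartz (f : 𝓢(ℝ, ℂ)) :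
    hat (f.toLp 2) =ᵐ[volume] fun ξ : ℝ => ∫ x : ℝ, f x * Complex.exp (-Complex.I * ξ * x) := by
  have hc : (0 : ℝ) < 2 * Real.pi := by positivity
  have h : (𝓕 (f.toLp 2 volume) : L2R) =ᵐ[volume] (𝓕 f : 𝓢(ℝ, ℂ)) := by
    rw [SchwartzMap.toLp_fourier_eq]
    exact SchwartzMap.coeFn_toLp _ _ _
  filter_upwards [(quasiMP_div hc).ae_eq_comp h] with ξ hξ
  simp only [Function.comp_apply] at hξ
  rw [hat, hξ, SchwartzMap.fourier_coe, Real.fourier_real_eq_integral_exp_smul]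
  refine integral_congr_ae (Eventually.of_forall fun x => ?_)
  simp only [smul_eq_mul]
  rw [mul_comm]
  congr 2
  have hp : (Real.pi : ℂ) ≠ 0 := by exact_mod_cast Real.pi_ne_zero
  push_cast
  field_simp

end SuperWavelet

end

/-! Test on vectors `f` whose only nonzero component is the `i`-th, with Fourier transform `1_A`,
and compute the frame energy of `U^j f` against the translates of `Φ` in two ways. On the Fourier
side translations become characters of period 1. If `A / N^j` fits in a unit interval, Parseval
there gives the integral over `A` of the local trace of component `σ^{-j} i` at `ξ / N^j`
(`frameEnergy_translates`); the phases have modulus one and disappear. On the geometric side, the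
tight frame property of `V 0` extends to its closure and, by projection, gives `‖f‖² - dist(U^j f, V
0)²` (`frameEnergy_eq`). Since `U^j` is isometric and maps `V j` onto `V 0`, this is `|A| - dist(f,
V j)²`. Equating the two yields `setLIntegral_localTrace`. As `A` is arbitrary, nesting of the `V j`
makes the rescaled traces increase a.e. and density forces their supremum to be 1. The permutation
is removed at the end because there are only finitely many components. -/

noncomputable section

namespace SuperWavelet

/-! ### Fourier transform of translations and dilations. -/

/-- Two continuous maps on `L²(ℝ)` that agree on Schwartz functions are equal. -/
theorem eq_of_eq_on_schwartz {X : Type*} [TopologicalSpace X] [T2Space X] {F G : L2R → X}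
    (hF : Continuous F) (hG : Continuous G)
    (h : ∀ f : 𝓢(ℝ, ℂ), F (f.toLp 2) = G (f.toLp 2)) : F = G :=
  (SchwartzMap.denseRange_toLpCLM (F := ℂ) (μ := (volume : Measure ℝ)) (p := 2)
    ENNReal.ofNat_ne_top).equalizer hF hG (funext fun f => h f)

theorem continuous_fourier_L2R : Continuous (fun f : L2R => (𝓕 f : L2R)) :=
  (Lp.fourierTransformₗᵢ ℝ ℂ).continuous

theorem fourier_dilIsometry {c : ℝ} (hc : 0 < c) (f : L2R) :
    (𝓕 (dilIsometry hc f) : L2R) = dilIsometry (inv_pos.2 hc) (𝓕 f : L2R) := by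
  refine congrFun (eq_of_eq_on_schwartz
    (continuous_fourier_L2R.comp (dilIsometry hc).continuous)
    ((dilIsometry (inv_pos.2 hc)).continuous.comp continuous_fourier_L2R) fun f => ?_) f
  have hs : Real.sqrt c ≠ 0 := (Real.sqrt_pos.2 hc).ne'
  have hsc : Real.sqrt c * Real.sqrt c = c := Real.mul_self_sqrt hc.le
  let g : 𝓢(ℝ, ℂ) := ((Real.sqrt c)⁻¹ : ℂ) • SchwartzMap.compCLMOfContinuousLinearEquiv ℂ
    (ContinuousLinearEquiv.unitsEquivAut ℝ (Units.mk0 c⁻¹ (inv_ne_zero hc.ne'))) f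
  have hg : ∀ x, g x = ((Real.sqrt c)⁻¹ : ℂ) * f (x / c) := fun x => by
    simp [g, div_eq_mul_inv]
  have h1 : dilIsometry hc (f.toLp 2) = g.toLp 2 := by
    apply Lp.ext
    filter_upwards [dilIsometry_coe hc (f.toLp 2), g.coeFn_toLp 2 volume,
      (quasiMP_div hc).ae_eq_comp (f.coeFn_toLp 2 volume)] with x h1 h2 h3
    rw [h1, h2, hg]
    exact congrArg _ h3
  change (𝓕 (dilIsometry hc (f.toLp 2)) : L2R) = dilIsometry (inv_pos.2 hc) (𝓕 (f.toLp 2) : L2R)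
  rw [h1, SchwartzMap.toLp_fourier_eq, SchwartzMap.toLp_fourier_eq]
  apply Lp.ext
  filter_upwards [dilIsometry_coe (inv_pos.2 hc) ((𝓕 f).toLp 2), (𝓕 g).coeFn_toLp 2 volume,
    (quasiMP_div (inv_pos.2 hc)).ae_eq_comp ((𝓕 f).coeFn_toLp 2 volume)] with x h1 h2 h3
  rw [h2, h1]
  simp only [Function.comp_apply] at h3
  rw [h3, SchwartzMap.fourier_coe, SchwartzMap.fourier_coe, Real.fourier_real_eq,
    Real.fourier_real_eq]
  have h4 := Measure.integral_comp_div
    (fun v : ℝ => Real.fourierChar (-(v * (x / c⁻¹))) • (((Real.sqrt c)⁻¹ : ℂ) * f v)) c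
  have h5 : ∀ v : ℝ, v / c * (x / c⁻¹) = v * x := fun v => by field_simp
  simp only [h5] at h4
  simp only [hg]
  rw [h4, abs_of_pos hc]
  have h6 : ∀ (w : Circle) (a b : ℂ), w • (a * b) = a * (w • b) := fun w a b => by
    rw [Circle.smul_def, Circle.smul_def, smul_eq_mul, smul_eq_mul, mul_left_comm]
  simp only [h6]
  rw [integral_const_mul, Real.sqrt_inv, Complex.real_smul]
  push_cast
  rw [inv_inv, ← mul_assoc]
  congr 1
  have hs' : (Real.sqrt c : ℂ) ≠ 0 := by exact_mod_cast hs
  field_simp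
  exact_mod_cast (by rw [sq, hsc] : c = Real.sqrt c ^ 2)

theorem fourier_T₀ (f : L2R) :
    (𝓕 (T₀ f) : L2R) =ᵐ[volume] fun ξ : ℝ => (Real.fourierChar (-ξ) : ℂ) * (𝓕 f : L2R) ξ := by
  have hm : MemLp (fun ξ : ℝ => (Real.fourierChar (-ξ) : ℂ)) ∞ (volume : Measure ℝ) :=
    memLp_top_of_bound (Continuous.aestronglyMeasurable (by fun_prop)) 1
      (Eventually.of_forall fun ξ => (Circle.norm_coe _).le)
  -- Multiplication by the character as a bounded operator turns the a.e. identity into an equality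
  -- of continuous maps, so that Schwartz functions suffice.
  let M : L2R →L[ℂ] L2R := (ContinuousLinearMap.mul ℂ ℂ).holderL volume ∞ 2 2 (hm.toLp _)
  have hM : ∀ g : L2R, M g =ᵐ[volume] fun ξ : ℝ => (Real.fourierChar (-ξ) : ℂ) * g ξ :=
    fun g => by
      filter_upwards [(ContinuousLinearMap.mul ℂ ℂ).coeFn_holder (r := 2) (hm.toLp _) g,
        hm.coeFn_toLp] with ξ h1 h2
      refine h1.trans ?_
      rw [h2]; rfl
  suffices h : (fun f : L2R => (𝓕 (T₀ f) : L2R)) = fun f => M (𝓕 f : L2R) by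
    rw [show (𝓕 (T₀ f) : L2R) = M (𝓕 f : L2R) from congrFun h f]
    exact hM _
  refine eq_of_eq_on_schwartz (continuous_fourier_L2R.comp T₀.continuous)
    (M.continuous.comp continuous_fourier_L2R) fun f => ?_
  let g : 𝓢(ℝ, ℂ) := f.compSubConstCLM ℂ 1
  have h1 : T₀ (f.toLp 2) = g.toLp 2 := by
    apply Lp.ext
    filter_upwards [T₀_coe (f.toLp 2), g.coeFn_toLp 2 volume,
      (measurePreserving_sub_right volume (1 : ℝ)).quasiMeasurePreserving.ae_eq_comp
        (f.coeFn_toLp 2 volume)] with x h1 h2 h3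
    rw [h1, h2]
    exact h3
  rw [h1, SchwartzMap.toLp_fourier_eq, SchwartzMap.toLp_fourier_eq]
  apply Lp.ext
  filter_upwards [hM ((𝓕 f).toLp 2), (𝓕 g).coeFn_toLp 2 volume,
    (𝓕 f).coeFn_toLp 2 volume] with x h1 h2 h3
  rw [h2, h1, h3, SchwartzMap.fourier_coe, SchwartzMap.fourier_coe, Real.fourier_real_eq,
    Real.fourier_real_eq,
    ← integral_sub_right_eq_self (fun v : ℝ => Real.fourierChar (-(v * x)) • f v) (1 : ℝ),
    ← integral_const_mul]
  refine integral_congr_ae (Eventually.of_forall fun v => ?_)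
  simp only [g, SchwartzMap.compSubConstCLM_apply, Circle.smul_def, smul_eq_mul]
  rw [← mul_assoc, ← Circle.coe_mul, ← AddChar.map_add_eq_mul]
  congr 3
  ring

theorem fourier_T₀_zpow (k : ℤ) (f : L2R) :
    (𝓕 ((T₀ ^ k) f) : L2R) =ᵐ[volume]
      fun ξ : ℝ => (Real.fourierChar (-(k * ξ)) : ℂ) * (𝓕 f : L2R) ξ := by
  have key : ∀ (k : ℤ), (𝓕 ((T₀ ^ (k + 1)) f) : L2R) =ᵐ[volume] fun ξ : ℝ =>
      (Real.fourierChar (-ξ) : ℂ) * (𝓕 ((T₀ ^ k) f) : L2R) ξ := fun k => by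
    rw [add_comm, zpow_add, zpow_one]
    exact fourier_T₀ _
  induction k using Int.induction_on with
  | zero => simp
  | succ k ih =>
    filter_upwards [key k, ih] with ξ h1 h2
    rw [h1, h2, ← mul_assoc, ← Circle.coe_mul, ← AddChar.map_add_eq_mul]
    congr 3
    push_cast
    ring
  | pred k ih =>
    have h := key (-k - 1)
    rw [sub_add_cancel] at h
    filter_upwards [h, ih] with ξ h1 h2
    have h3 : (Real.fourierChar ξ : ℂ) * Real.fourierChar (-ξ) = 1 := by
      rw [← Circle.coe_mul, ← AddChar.map_add_eq_mul, add_neg_cancel]; simp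
    rw [← one_mul ((𝓕 ((T₀ ^ (-(k : ℤ) - 1)) f) : L2R) ξ), ← h3, mul_assoc, ← h1, h2, ← mul_assoc,
      ← Circle.coe_mul, ← AddChar.map_add_eq_mul]
    congr 3
    push_cast
    ring

theorem fourier_U₀_pow (N : ℕ) (hN : 2 ≤ N) (j : ℕ) (f : L2R) :
    (𝓕 ((U₀ N hN ^ j) f) : L2R) =ᵐ[volume]
      fun ξ : ℝ => (Real.sqrt N : ℂ) ^ j * (𝓕 f : L2R) ((N : ℝ) ^ j * ξ) := by
  have hc : (0 : ℝ) < N := by exact_mod_cast (by omega : 0 < N)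
  induction j with
  | zero => simp
  | succ j ih =>
    rw [pow_succ', show (U₀ N hN * U₀ N hN ^ j) f = dilIsometry hc ((U₀ N hN ^ j) f) from rfl,
      fourier_dilIsometry]
    filter_upwards [dilIsometry_coe (inv_pos.2 hc) (𝓕 ((U₀ N hN ^ j) f)),
      (quasiMP_div (inv_pos.2 hc)).ae_eq_comp ih] with ξ h1 h2
    simp only [Function.comp_apply] at h2
    rw [h1, h2, Real.sqrt_inv]
    push_cast
    rw [inv_inv, pow_succ', mul_assoc]
    congr 3
    field_simp
    ring

/-! ### Frame energy of a normalized tight frame for a possibly non-closed subspace. -/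

theorem ennreal_sq_rpow_half (x : ℝ≥0∞) : (x ^ 2) ^ (1 / 2 : ℝ) = x := by
  rw [← ENNReal.rpow_natCast, ← ENNReal.rpow_mul]; norm_num

section Frame

variable {H ι : Type*} [NormedAddCommGroup H] [InnerProductSpace ℂ H]

/-- The frame energy `∑ᵢ |⟨eᵢ, f⟩|²` with values in `[0, ∞]`. -/
def frameEnergy (e : ι → H) (f : H) : ℝ≥0∞ := ∑' i, ‖inner ℂ (e i) f‖ₑ ^ 2

theorem frameEnergy_eq_of_hasSum {e : ι → H} {f : H}
    (h : HasSum (fun i => ‖inner ℂ (e i) f‖ ^ 2) (‖f‖ ^ 2)) : frameEnergy e f = ‖f‖ₑ ^ 2 := by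
  have h1 := ENNReal.ofReal_tsum_of_nonneg (fun i => sq_nonneg ‖inner ℂ (e i) f‖) h.summable
  rw [h.tsum_eq] at h1
  simp only [ENNReal.ofReal_pow (norm_nonneg _), ofReal_norm] at h1
  exact h1.symm

/-- Writing the energy as an `L²` norm for counting measure makes Minkowski's inequality available
in `[0, ∞]`, with no summability to check. -/
theorem frameEnergy_rpow (e : ι → H) (f : H) :
    frameEnergy e f ^ (1 / 2 : ℝ) =
      @eLpNorm ι ℂ _ ⊤ (fun i => inner ℂ (e i) f) 2 (@Measure.count ι ⊤) := by
  let _ : MeasurableSpace ι := ⊤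
  rw [eLpNorm_eq_lintegral_rpow_enorm_toReal (by norm_num) (by norm_num), lintegral_count]
  simp only [frameEnergy, ENNReal.toReal_ofNat, ENNReal.rpow_two]

theorem frameEnergy_add_rpow_le (e : ι → H) (f g : H) :
    frameEnergy e (f + g) ^ (1 / 2 : ℝ) ≤
      frameEnergy e f ^ (1 / 2 : ℝ) + frameEnergy e g ^ (1 / 2 : ℝ) := by
  let _ : MeasurableSpace ι := ⊤
  have hm : ∀ f : H, AEStronglyMeasurable (fun i => inner ℂ (e i) f) (Measure.count (α := ι)) :=
    fun f => (measurable_from_top (f := fun i => inner ℂ (e i) f)).aestronglyMeasurable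
  simp only [frameEnergy_rpow]
  have := eLpNorm_add_le (hm f) (hm g) (p := 2) (by norm_num)
  convert this using 2
  ext i
  simp

/-- Finite partial sums are continuous in `f`, so an upper bound survives closure. The full sum is
only lower semicontinuous; the reverse bound needs a separate argument. -/
theorem frameEnergy_le_of_mem_closure {e : ι → H} {K : Submodule ℂ H}
    (h : ∀ f ∈ K, frameEnergy e f = ‖f‖ₑ ^ 2) {f : H} (hf : f ∈ K.topologicalClosure) :
    frameEnergy e f ≤ ‖f‖ₑ ^ 2 := by
  have key : ∀ s : Finset ι, ∑ i ∈ s, ‖inner ℂ (e i) f‖ₑ ^ 2 ≤ ‖f‖ₑ ^ 2 := fun s => by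
    have hc : IsClosed {f : H | ∑ i ∈ s, ‖inner ℂ (e i) f‖ₑ ^ 2 ≤ ‖f‖ₑ ^ 2} :=
      isClosed_le (by fun_prop) (by fun_prop)
    exact closure_minimal (fun g hg => (ENNReal.sum_le_tsum s).trans (h g hg).le) hc hf
  rw [frameEnergy, ENNReal.tsum_eq_iSup_sum]
  exact iSup_le key

theorem frameEnergy_eq_of_mem_closure {e : ι → H} {K : Submodule ℂ H}
    (h : ∀ f ∈ K, frameEnergy e f = ‖f‖ₑ ^ 2) {f : H} (hf : f ∈ K.topologicalClosure) :
    frameEnergy e f = ‖f‖ₑ ^ 2 := by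
  refine le_antisymm (frameEnergy_le_of_mem_closure h hf) ?_
  suffices h2 : ‖f‖ₑ ≤ frameEnergy e f ^ (1 / 2 : ℝ) by
    rw [← ennreal_sq_rpow_half ‖f‖ₑ] at h2
    exact (ENNReal.rpow_le_rpow_iff (by norm_num)).1 h2
  obtain ⟨u, hu, hlim⟩ := mem_closure_iff_seq_limit.1 hf
  -- Minkowski for `u n = f + (u n - f)`; the error term is controlled by the upper bound already
  -- known on the closure.
  have h3 : ∀ n, ‖u n‖ₑ ≤ frameEnergy e f ^ (1 / 2 : ℝ) + ‖u n - f‖ₑ := fun n => by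
    have h4 := frameEnergy_add_rpow_le e f (u n - f)
    rw [add_sub_cancel, h _ (hu n), ennreal_sq_rpow_half] at h4
    refine h4.trans (add_le_add_right ?_ _)
    rw [← ennreal_sq_rpow_half ‖u n - f‖ₑ]
    exact ENNReal.rpow_le_rpow (frameEnergy_le_of_mem_closure h
      (K.topologicalClosure.sub_mem (K.le_topologicalClosure (hu n)) hf)) (by norm_num)
  have h5 : Tendsto (fun n => frameEnergy e f ^ (1 / 2 : ℝ) + ‖u n - f‖ₑ) atTop
      (𝓝 (frameEnergy e f ^ (1 / 2 : ℝ) + ‖(0 : H)‖ₑ)) := by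
    refine Tendsto.const_add _ ?_
    have : Tendsto (fun n => u n - f) atTop (𝓝 0) := by
      simpa using hlim.sub_const f
    exact this.enorm
  simpa using le_of_tendsto_of_tendsto' hlim.enorm h5 h3

/-- The frame vectors see only the projection of `f` onto the closure of `K`; Pythagoras then
expresses its norm through the distance, a form convenient for moving along isometries and comparing
nested subspaces. -/
theorem frameEnergy_eq [CompleteSpace H] {e : ι → H} {K : Submodule ℂ H} (he : ∀ i, e i ∈ K)
    (h : ∀ f ∈ K, frameEnergy e f = ‖f‖ₑ ^ 2) (f : H) :
    frameEnergy e f = ENNReal.ofReal (‖f‖ ^ 2 - Metric.infDist f K ^ 2) := by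
  set P := K.topologicalClosure.starProjection
  have hP : P f ∈ K.topologicalClosure := Submodule.starProjection_apply_mem _ f
  have h1 : frameEnergy e f = frameEnergy e (P f) := by
    refine tsum_congr fun i => ?_
    have h2 := Submodule.starProjection_inner_eq_zero (K := K.topologicalClosure) f (e i)
      (K.le_topologicalClosure (he i))
    rw [inner_eq_zero_symm, inner_sub_right, sub_eq_zero] at h2
    rw [h2]
  have h3 : Metric.infDist f K = ‖f - P f‖ := by
    rw [← Metric.infDist_closure, ← Submodule.topologicalClosure_coe, Metric.infDist_eq_iInf,
      Submodule.starProjection_minimal]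
    simp only [dist_eq_norm]
    rfl
  have h4 : ‖f‖ ^ 2 = ‖P f‖ ^ 2 + ‖f - P f‖ ^ 2 := by
    have h5 := norm_add_sq_eq_norm_sq_add_norm_sq_of_inner_eq_zero (𝕜 := ℂ) (P f) (f - P f)
      (inner_eq_zero_symm.1 (Submodule.starProjection_inner_eq_zero f _ hP))
    rw [add_sub_cancel] at h5
    simpa only [sq] using h5
  rw [h1, frameEnergy_eq_of_mem_closure h hP, h3, h4, add_sub_cancel_right,
    ENNReal.ofReal_pow (norm_nonneg _), ofReal_norm]

/-- A nonzero `e i` is non-orthogonal to some element of a countable dense set, and finite energy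
allows each such element only countably many `i`. -/
theorem countable_ne_zero_of_frameEnergy_ne_top [TopologicalSpace.SeparableSpace H] {e : ι → H}
    (h : ∀ f, frameEnergy e f ≠ ∞) : {i | e i ≠ 0}.Countable := by
  obtain ⟨D, hD, hd⟩ := TopologicalSpace.exists_countable_dense H
  refine (hD.biUnion fun f _ => Summable.countable_support_ennreal (h f)).mono fun i hi => ?_
  by_contra hc
  simp only [Set.mem_iUnion, not_exists, Function.mem_support, not_not] at hc
  refine hi (hd.eq_zero_of_inner_left (𝕜 := ℂ) fun v hv => ?_)
  simpa using hc v hv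

end Frame

/-- Countability gives measurability of the local trace and the exchange of its sum with integrals.
-/
theorem countable_of_isNTFGenerator {n : ℕ} {z : Fin n → Circle} {Φ : Set (L2Rn n)}
    {V : Submodule ℂ (L2Rn n)} (hΦ : IsNTFGenerator z Φ V) : Φ.Countable := by
  have : Fact ((2 : ℝ≥0∞) ≠ ∞) := ⟨by norm_num⟩
  have h := countable_ne_zero_of_frameEnergy_ne_top (fun f => by
    rw [frameEnergy_eq hΦ.2.1 (fun f hf => frameEnergy_eq_of_hasSum (hΦ.2.2 f hf)) f]
    exact ENNReal.ofReal_ne_top)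
  refine ((h.image fun p => (p.2 : L2Rn n)).insert 0).mono fun φ hφ => ?_
  by_cases h0 : φ = 0
  · exact Or.inl h0
  · exact Or.inr ⟨(0, ⟨φ, hφ⟩), by simpa using h0, rfl⟩

/-! ### The local trace, and the energy of test vectors by Parseval. -/

/-- Parseval's identity on the interval `(a, a + 1]`. -/
theorem tsum_integral_fourierChar_eq {a : ℝ} {h : ℝ → ℂ} (hh : MemLp h 2 volume) {A : Set ℝ}
    (hA : MeasurableSet A) (hAa : A ⊆ Set.Ioc a (a + 1)) :
    ∑' k : ℤ, ‖∫ ξ in A, (Real.fourierChar (-(k * ξ)) : ℂ) * h ξ‖ₑ ^ 2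
      = ∫⁻ ξ in A, ‖h ξ‖ₑ ^ 2 := by
  have hab : a < a + 1 := by linarith
  have hm : MemLp (A.indicator h) 2 (volume.restrict (Set.Ioc a (a + 1))) :=
    (hh.indicator hA).restrict _
  have hsum := hasSum_sq_fourierCoeffOn hab hm
  have hT : a + 1 - a = 1 := by ring
  have hcoef : ∀ k : ℤ, fourierCoeffOn hab (A.indicator h) k =
      ∫ ξ in A, (Real.fourierChar (-(k * ξ)) : ℂ) * h ξ := fun k => by
    rw [fourierCoeffOn_eq_integral, intervalIntegral.integral_of_le hab.le,
      show 1 / (a + 1 - a) = 1 by rw [hT, div_one], one_smul]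
    have : ∀ x : ℝ, fourier (-k) (x : AddCircle (a + 1 - a)) • A.indicator h x =
        A.indicator (fun ξ => (Real.fourierChar (-(k * ξ)) : ℂ) * h ξ) x := fun x => by
      by_cases hx : x ∈ A
      · rw [Set.indicator_of_mem hx, Set.indicator_of_mem hx, fourier_coe_apply,
          Real.fourierChar_apply, smul_eq_mul]
        congr 2
        have h1 : (a : ℂ) + 1 - a = 1 := by ring
        push_cast
        rw [h1]
        ring
      · simp [hx]
    simp only [this]
    rw [setIntegral_indicator hA, Set.inter_eq_right.2 hAa]
  have h1 := ENNReal.ofReal_tsum_of_nonneg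
    (fun k => sq_nonneg ‖fourierCoeffOn hab (A.indicator h) k‖) hsum.summable
  simp only [ENNReal.ofReal_pow (norm_nonneg _), ofReal_norm, hcoef] at h1
  have h2 : ∑' k : ℤ, ‖∫ ξ in A, (Real.fourierChar (-(k * ξ)) : ℂ) * h ξ‖ ^ 2 =
      ∫ ξ in A, ‖h ξ‖ ^ 2 := by
    simp only [← hcoef]
    rw [hsum.tsum_eq, hT, inv_one, one_smul, intervalIntegral.integral_of_le hab.le]
    have : ∀ x : ℝ, ‖A.indicator h x‖ ^ 2 = A.indicator (fun ξ => ‖h ξ‖ ^ 2) x := fun x => by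
      by_cases hx : x ∈ A <;> simp [hx]
    simp only [this]
    rw [setIntegral_indicator hA, Set.inter_eq_right.2 hAa]
  rw [← h1, h2, ofReal_integral_eq_lintegral_ofReal (hh.integrable_norm_pow two_ne_zero).restrict
    (Eventually.of_forall fun ξ => sq_nonneg _)]
  simp only [ENNReal.ofReal_pow (norm_nonneg _), ofReal_norm]

/-- The function `ξ ↦ ∑_{φ ∈ Φ} |𝓕 φᵢ (ξ)|²`, a diagonal entry of the local trace function. -/
def localTrace {n : ℕ} (Φ : Set (L2Rn n)) (i : Fin n) (ξ : ℝ) : ℝ≥0∞ :=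
  ∑' φ : Φ, ‖(𝓕 ((φ : L2Rn n) i) : L2R) ξ‖ₑ ^ 2

theorem measurable_localTrace {n : ℕ} {Φ : Set (L2Rn n)} (hΦ : Φ.Countable) (i : Fin n) :
    Measurable (localTrace Φ i) := by
  have := hΦ.to_subtype
  exact Measurable.tsum fun φ => (Lp.stronglyMeasurable _).measurable.enorm.pow_const 2

theorem T_zpow_apply {n : ℕ} (z : Fin n → Circle) (k : ℤ) (f : L2Rn n) (i : Fin n) :
    (T z ^ k) f i = ((z i ^ k : Circle) : ℂ) • (T₀ ^ k) (f i) := by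
  have key : ∀ k : ℤ, (T z ^ (k + 1)) f i = (z i : ℂ) • T₀ ((T z ^ k) f i) := fun k => by
    rw [add_comm, zpow_add, zpow_one]
    rfl
  have key' : ∀ (k : ℤ) (g : L2R), (T₀ ^ (k + 1)) g = T₀ ((T₀ ^ k) g) := fun k g => by
    rw [add_comm, zpow_add, zpow_one]
    rfl
  induction k using Int.induction_on with
  | zero => simp
  | succ k ih =>
    rw [key, ih, key', map_smul, smul_smul, zpow_add, zpow_one, Circle.coe_mul, mul_comm]
  | pred k ih =>
    have h := key (-k - 1)
    have h' := key' (-k - 1) (f i)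
    rw [sub_add_cancel] at h h'
    rw [ih, h', ← map_smul T₀, ← map_smul T₀] at h
    have h2 := T₀.injective h
    have h3 : ((z i ^ (-(k : ℤ) - 1) : Circle) : ℂ) = (z i : ℂ)⁻¹ * (z i ^ (-(k : ℤ)) : Circle) := by
      rw [zpow_sub_one, Circle.coe_mul, Circle.coe_inv, mul_comm]
    rw [h3, mul_smul, h2, smul_smul, inv_mul_cancel₀ (z i).coe_ne_zero, one_smul]

theorem U_pow_apply {n : ℕ} (N : ℕ) (hN : 2 ≤ N) (σ : Equiv.Perm (Fin n)) (j : ℕ) (f : L2Rn n)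
    (i : Fin n) : (U N hN σ ^ j) f i = (U₀ N hN ^ j) (f ((σ ^ j) i)) := by
  induction j generalizing i with
  | zero => simp
  | succ j ih =>
    rw [pow_succ', pow_succ', pow_succ]
    change U N hN σ ((U N hN σ ^ j) f) i = U₀ N hN ((U₀ N hN ^ j) (f ((σ ^ j) (σ i))))
    rw [U_apply, ih]

/-- The modulus of a frame coefficient of a function whose transform is `c` times an indicator. -/
theorem enorm_inner_T₀_zpow {A : Set ℝ} (hA : MeasurableSet A) (k : ℤ) (c : ℂ) (φ g : L2R)
    (hg : (𝓕 g : L2R) =ᵐ[volume] A.indicator fun _ => c) :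
    ‖inner ℂ ((T₀ ^ k) φ) g‖ₑ =
      ‖c‖ₑ * ‖∫ ξ in A, (Real.fourierChar (-(k * ξ)) : ℂ) * (𝓕 φ : L2R) ξ‖ₑ := by
  have h1 : inner ℂ ((T₀ ^ k) φ) g =
      c * starRingEnd ℂ (∫ ξ in A, (Real.fourierChar (-(k * ξ)) : ℂ) * (𝓕 φ : L2R) ξ) := by
    rw [← Lp.inner_fourier_eq, L2.inner_def, ← integral_conj, ← integral_const_mul,
      ← integral_indicator hA]
    refine integral_congr_ae ?_
    filter_upwards [fourier_T₀_zpow k φ, hg] with ξ h1 h2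
    rw [h1, h2]
    by_cases hξ : ξ ∈ A
    · rw [Set.indicator_of_mem hξ, Set.indicator_of_mem hξ, RCLike.inner_apply]
    · rw [Set.indicator_of_notMem hξ, Set.indicator_of_notMem hξ, inner_zero_right]
  rw [h1, enorm_mul, RCLike.enorm_conj]

theorem frameEnergy_translates {n : ℕ} (z : Fin n → Circle) {Φ : Set (L2Rn n)} (hΦ : Φ.Countable)
    {a : ℝ} {A : Set ℝ} (hA : MeasurableSet A) (hAa : A ⊆ Set.Ioc a (a + 1)) (c : ℂ) (f : L2Rn n)
    (i : Fin n) (hf : ∀ k, k ≠ i → f k = 0)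
    (hfi : (𝓕 (f i) : L2R) =ᵐ[volume] A.indicator fun _ => c) :
    frameEnergy (fun p : ℤ × Φ => (T z ^ p.1) (p.2 : L2Rn n)) f =
      ‖c‖ₑ ^ 2 * ∫⁻ ξ in A, localTrace Φ i ξ := by
  have := hΦ.to_subtype
  have h1 : ∀ (k : ℤ) (φ : Φ), ‖inner ℂ ((T z ^ k) (φ : L2Rn n)) f‖ₑ ^ 2 = ‖c‖ₑ ^ 2 *
      ‖∫ ξ in A, (Real.fourierChar (-(k * ξ)) : ℂ) *
        (𝓕 ((φ : L2Rn n) i) : L2R) ξ‖ₑ ^ 2 := fun k φ => by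
    rw [PiLp.inner_apply, Finset.sum_eq_single i (fun k _ hk => by rw [hf k hk, inner_zero_right])
      (fun h => absurd (Finset.mem_univ i) h), T_zpow_apply, inner_smul_left, enorm_mul,
      RCLike.enorm_conj, enorm_inner_T₀_zpow hA k c _ _ hfi, ← mul_pow]
    congr 1
    rw [← ofReal_norm, Circle.norm_coe, ENNReal.ofReal_one, one_mul]
  simp only [frameEnergy, h1]
  -- Summing over `k` inside the sum over `φ` lets Parseval act on each generator separately.
  rw [ENNReal.tsum_prod (f := fun (k : ℤ) (φ : Φ) => ‖c‖ₑ ^ 2 *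
    ‖∫ ξ in A, (Real.fourierChar (-(k * ξ)) : ℂ) * (𝓕 ((φ : L2Rn n) i) : L2R) ξ‖ₑ ^ 2),
    ENNReal.tsum_comm]
  simp only [ ENNReal.tsum_mul_left]
  congr 1
  simp only [localTrace]
  rw [lintegral_tsum fun φ =>
    ((Lp.stronglyMeasurable _).measurable.enorm.pow_const 2).aemeasurable]
  exact tsum_congr fun φ => tsum_integral_fourierChar_eq (Lp.memLp _) hA hAa

/-! ### Approximation by the spaces `V j`, and the fundamental identity. -/

theorem IsGMRA.image_U_pow {n N : ℕ} {hN : 2 ≤ N} {σ : Equiv.Perm (Fin n)} {z : Fin n → Circle}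
    {V : ℤ → Submodule ℂ (L2Rn n)} (hV : IsGMRA N hN σ z V) (j : ℕ) :
    (U N hN σ ^ j) '' (V j : Set (L2Rn n)) = V 0 := by
  induction j with
  | zero => simp
  | succ j ih =>
    have h : U N hN σ '' (V ((j + 1 : ℕ) : ℤ) : Set (L2Rn n)) = V j := by
      have h1 := congrArg (fun W : Submodule ℂ (L2Rn n) => (W : Set (L2Rn n)))
        (hV.map_U ((j + 1 : ℕ) : ℤ))
      rw [show (((j + 1 : ℕ) : ℤ) - 1) = j by push_cast; ring] at h1
      exact h1
    rw [pow_succ, ← ih, ← h, Set.image_image]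
    rfl

theorem IsGMRA.monotone {n N : ℕ} {hN : 2 ≤ N} {σ : Equiv.Perm (Fin n)} {z : Fin n → Circle}
    {V : ℤ → Submodule ℂ (L2Rn n)} (hV : IsGMRA N hN σ z V) : Monotone V :=
  monotone_int_of_le_succ hV.le_succ

theorem IsGMRA.antitone_infDist {n N : ℕ} {hN : 2 ≤ N} {σ : Equiv.Perm (Fin n)}
    {z : Fin n → Circle} {V : ℤ → Submodule ℂ (L2Rn n)} (hV : IsGMRA N hN σ z V) (f : L2Rn n) :
    Antitone fun j : ℤ => Metric.infDist f (V j : Set (L2Rn n)) :=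
  fun _ _ h => Metric.infDist_le_infDist_of_subset (hV.monotone h) ⟨0, zero_mem _⟩

theorem IsGMRA.tendsto_infDist {n N : ℕ} {hN : 2 ≤ N} {σ : Equiv.Perm (Fin n)}
    {z : Fin n → Circle} {V : ℤ → Submodule ℂ (L2Rn n)} (hV : IsGMRA N hN σ z V) (f : L2Rn n) :
    Tendsto (fun j : ℕ => Metric.infDist f (V j : Set (L2Rn n))) atTop (𝓝 0) := by
  rw [Metric.tendsto_atTop]
  intro ε hε
  obtain ⟨v, hv, hd⟩ := Metric.mem_closure_iff.1 (hV.dense_iUnion f) ε hε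
  obtain ⟨k, hk⟩ := Set.mem_iUnion.1 hv
  refine ⟨k.toNat, fun j hj => ?_⟩
  rw [Real.dist_0_eq_abs, abs_of_nonneg Metric.infDist_nonneg]
  exact (Metric.infDist_le_dist_of_mem (hV.monotone (by omega) hk)).trans_lt hd

/-- The vector whose `i`-th component has transform `1_A` and whose other components vanish. -/
def indicatorVec {n : ℕ} (i : Fin n) {A : Set ℝ} (hA : MeasurableSet A) (hA' : volume A ≠ ∞) :
    L2Rn n :=
  PiLp.single 2 i (𝓕⁻ (indicatorConstLp 2 hA hA' (1 : ℂ)) : L2R)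

theorem norm_indicatorVec_sq {n : ℕ} (i : Fin n) {A : Set ℝ} (hA : MeasurableSet A)
    (hA' : volume A ≠ ∞) : ‖indicatorVec i hA hA'‖ ^ 2 = (volume A).toReal := by
  have h1 : ‖indicatorVec i hA hA'‖ = ‖(𝓕⁻ (indicatorConstLp 2 hA hA' (1 : ℂ)) : L2R)‖ :=
    PiLp.norm_single 2 (fun _ : Fin n => L2R) i _
  have h2 : ‖(𝓕⁻ (indicatorConstLp 2 hA hA' (1 : ℂ)) : L2R)‖ =
      ‖(indicatorConstLp 2 hA hA' (1 : ℂ) : L2R)‖ := (Lp.fourierTransformₗᵢ ℝ ℂ).symm.norm_map _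
  rw [h1, h2, norm_indicatorConstLp (by norm_num) (by norm_num), norm_one, one_mul,
    ← Real.rpow_natCast, ← Real.rpow_mul measureReal_nonneg]
  norm_num [Measure.real]

variable {n N : ℕ} {hN : 2 ≤ N} {σ : Equiv.Perm (Fin n)} {z : Fin n → Circle}
  {V : ℤ → Submodule ℂ (L2Rn n)} {Φ : Set (L2Rn n)}

/-- The fundamental identity: the integral of the `j`-th rescaled local trace measures how well
`V j` approximates the test vector of `A`. -/
theorem setLIntegral_localTrace (hV : IsGMRA N hN σ z V) (hΦ : IsNTFGenerator z Φ (V 0))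
    (i : Fin n) (j : ℕ) (a : ℝ) {A : Set ℝ} (hA : MeasurableSet A) (hA' : volume A ≠ ∞)
    (hAa : ∀ ξ ∈ A, ξ / (N : ℝ) ^ j ∈ Set.Ioc a (a + 1)) :
    ∫⁻ ξ in A, localTrace Φ ((σ ^ j).symm i) (ξ / (N : ℝ) ^ j) =
      ENNReal.ofReal ((volume A).toReal -
        Metric.infDist (indicatorVec i hA hA') (V j : Set (L2Rn n)) ^ 2) := by
  have hc : (0 : ℝ) < (N : ℝ) ^ j := pow_pos (by exact_mod_cast (by omega : 0 < N)) _
  have hcount := countable_of_isNTFGenerator hΦ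
  set f := indicatorVec i hA hA' with hf
  have hB : MeasurableSet ((fun ξ : ℝ => (N : ℝ) ^ j * ξ) ⁻¹' A) :=
    (measurable_const_mul _) hA
  have hBa : (fun ξ : ℝ => (N : ℝ) ^ j * ξ) ⁻¹' A ⊆ Set.Ioc a (a + 1) := fun ξ hξ => by
    have := hAa _ hξ
    rwa [mul_div_cancel_left₀ _ hc.ne'] at this
  have h1 := frameEnergy_eq hΦ.2.1 (fun f hf => frameEnergy_eq_of_hasSum (hΦ.2.2 f hf))
    ((U N hN σ ^ j) f)
  -- The distance from `U^j f` to `V 0 = U^j (V j)` becomes the distance from `f` to `V j`.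
  rw [LinearIsometryEquiv.norm_map, hf, norm_indicatorVec_sq, ← hf, ← hV.image_U_pow j,
    Metric.infDist_image (U N hN σ ^ j).isometry] at h1
  -- `U^j` moves component `i` to `σ^{-j} i`, with transform `N^{j/2}` times the indicator of
  -- `N^{-j} A`. The squared height `N^j` is the Jacobian of the change of variables back to `A`.
  rw [← h1, frameEnergy_translates z hcount hB hBa ((Real.sqrt N : ℂ) ^ j) _ ((σ ^ j).symm i)]
  · have h2 : ‖(Real.sqrt N : ℂ) ^ j‖ₑ ^ 2 = ENNReal.ofReal ((N : ℝ) ^ j) := by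
      rw [← ofReal_norm, ← ENNReal.ofReal_pow (norm_nonneg _), norm_pow, Complex.norm_real,
        Real.norm_of_nonneg (Real.sqrt_nonneg _), ← pow_mul, mul_comm, pow_mul,
        Real.sq_sqrt (Nat.cast_nonneg N)]
    rw [h2, ← lintegral_indicator hA, ← lintegral_indicator hB]
    have h3 := lintegral_map (μ := (volume : Measure ℝ)) (((measurable_localTrace hcount
      ((σ ^ j).symm i)).comp (measurable_id.div_const ((N : ℝ) ^ j))).indicator hA)
      (measurable_const_mul ((N : ℝ) ^ j))
    rw [Real.map_volume_mul_left hc.ne', lintegral_smul_measure, abs_of_pos (inv_pos.2 hc)] at h3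
    have h4 : ∀ ξ : ℝ, A.indicator (localTrace Φ ((σ ^ j).symm i) ∘ fun x => id x / (N : ℝ) ^ j)
        ((N : ℝ) ^ j * ξ) = ((fun ξ : ℝ => (N : ℝ) ^ j * ξ) ⁻¹' A).indicator
          (localTrace Φ ((σ ^ j).symm i)) ξ := fun ξ => by
      by_cases hξ : (N : ℝ) ^ j * ξ ∈ A
      · rw [Set.indicator_of_mem hξ, Set.indicator_of_mem (by exact hξ)]
        simp [mul_div_cancel_left₀ _ hc.ne']
      · rw [Set.indicator_of_notMem hξ, Set.indicator_of_notMem (by exact hξ)]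
    simp only [h4] at h3
    rw [← h3, smul_eq_mul, ← mul_assoc, ← ENNReal.ofReal_mul hc.le, mul_inv_cancel₀ hc.ne',
      ENNReal.ofReal_one, one_mul]
    rfl
  · intro k hk
    rw [U_pow_apply]
    have : f ((σ ^ j) k) = 0 := Pi.single_eq_of_ne (fun h => hk (by rw [← h]; simp)) _
    rw [this, map_zero]
  · rw [U_pow_apply, Equiv.apply_symm_apply]
    have hfi : (𝓕 (f i) : L2R) =ᵐ[volume] A.indicator fun _ => (1 : ℂ) := by
      have : f i = (𝓕⁻ (indicatorConstLp 2 hA hA' (1 : ℂ)) : L2R) := Pi.single_eq_same _ _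
      rw [this, FourierTransform.fourier_fourierInv_eq]
      exact indicatorConstLp_coeFn
    have hq : Measure.QuasiMeasurePreserving (fun ξ : ℝ => (N : ℝ) ^ j * ξ) volume volume := by
      convert quasiMP_div (inv_pos.2 hc) using 2 with ξ
      field_simp
    filter_upwards [fourier_U₀_pow N hN j (f i), hq.ae_eq_comp hfi] with ξ h1 h2
    simp only [Function.comp_apply] at h2
    rw [h1, h2]
    by_cases hξ : (N : ℝ) ^ j * ξ ∈ A
    · rw [Set.indicator_of_mem hξ, Set.indicator_of_mem (by exact hξ), mul_one]
    · rw [Set.indicator_of_notMem hξ, Set.indicator_of_notMem (by exact hξ), mul_zero]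

/-! ### Almost everywhere bound and limit of the local trace. -/

/-- Drop the distance term in the identity at `j = 0` on each unit interval. This bound supplies
finiteness at every scale, which the limit alone would not. -/
theorem localTrace_le_one (hV : IsGMRA N hN σ z V) (hΦ : IsNTFGenerator z Φ (V 0)) (i : Fin n) :
    ∀ᵐ ξ : ℝ, localTrace Φ i ξ ≤ 1 := by
  have hm := measurable_localTrace (countable_of_isNTFGenerator hΦ) i
  have h1 : ∀ k : ℤ, ∀ᵐ ξ : ℝ, ξ ∈ Set.Ioc (k : ℝ) (k + 1) → localTrace Φ i ξ ≤ 1 := fun k => by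
    rw [← ae_restrict_iff' measurableSet_Ioc]
    refine ae_le_of_forall_setLIntegral_le_of_sigmaFinite (g := fun _ => 1) hm fun s hs _ => ?_
    have hs' : volume (s ∩ Set.Ioc (k : ℝ) (k + 1)) ≠ ∞ :=
      measure_ne_top_of_subset Set.inter_subset_right (by simp)
    rw [Measure.restrict_restrict hs]
    have h2 := setLIntegral_localTrace hV hΦ i 0 k (hs.inter measurableSet_Ioc) hs'
      (fun ξ hξ => by simpa using hξ.2)
    simp only [pow_zero, div_one, show (1 : Equiv.Perm (Fin n)).symm i = i from rfl] at h2
    rw [h2, setLIntegral_one, ← ENNReal.ofReal_toReal hs']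
    refine ENNReal.ofReal_le_ofReal ?_
    rw [ENNReal.toReal_ofReal ENNReal.toReal_nonneg]
    linarith [sq_nonneg (Metric.infDist (indicatorVec i (hs.inter measurableSet_Ioc) hs')
      (V (0 : ℕ) : Set (L2Rn n)))]
  filter_upwards [ae_all_iff.2 h1] with ξ hξ
  refine hξ (⌈ξ⌉ - 1) ⟨?_, ?_⟩ <;> push_cast
  · linarith [Int.ceil_lt_add_one ξ]
  · linarith [Int.le_ceil ξ]

theorem tendsto_localTrace_perm (hV : IsGMRA N hN σ z V) (hΦ : IsNTFGenerator z Φ (V 0))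
    (i : Fin n) : ∀ᵐ ξ : ℝ, Tendsto (fun j : ℕ =>
      localTrace Φ ((σ ^ j).symm i) (ξ / (N : ℝ) ^ j)) atTop (𝓝 1) := by
  have hN1 : (1 : ℝ) < N := by exact_mod_cast (by omega : 1 < N)
  have hN0 : (0 : ℝ) < N := zero_lt_one.trans hN1
  set G : ℕ → ℝ → ℝ≥0∞ := fun j ξ => localTrace Φ ((σ ^ j).symm i) (ξ / (N : ℝ) ^ j) with hG
  have hGm : ∀ j, Measurable (G j) := fun j =>
    (measurable_localTrace (countable_of_isNTFGenerator hΦ) _).comp (measurable_id.div_const _)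
  -- On this window every scale `J + j` sends `ξ` into `(-1/2, 1/2]`, so the identity applies at all
  -- these scales with the single choice `a = -1/2`.
  have hJ : ∀ J : ℕ, ∀ᵐ ξ : ℝ, ξ ∈ Set.Ioc (-(N : ℝ) ^ J / 2) ((N : ℝ) ^ J / 2) →
      Tendsto (fun j => G j ξ) atTop (𝓝 1) := fun J => by
    rw [← ae_restrict_iff' measurableSet_Ioc]
    set B := Set.Ioc (-(N : ℝ) ^ J / 2) ((N : ℝ) ^ J / 2) with hB
    have hBm : MeasurableSet B := measurableSet_Ioc
    have hfin : ∀ s : Set ℝ, volume (s ∩ B) ≠ ∞ := fun s =>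
      measure_ne_top_of_subset Set.inter_subset_right (by simp [hB])
    have hint : ∀ s (hs : MeasurableSet s) (j : ℕ), ∫⁻ ξ in s, G (J + j) ξ ∂volume.restrict B =
        ENNReal.ofReal ((volume (s ∩ B)).toReal - Metric.infDist
          (indicatorVec i (hs.inter hBm) (hfin s))
            (V ((J + j : ℕ) : ℤ) : Set (L2Rn n)) ^ 2) := fun s hs j => by
      rw [Measure.restrict_restrict hs]
      refine setLIntegral_localTrace hV hΦ i (J + j) (-1 / 2) (hs.inter hBm) (hfin s)
        fun ξ hξ => ?_
      have hp : (0 : ℝ) < (N : ℝ) ^ (J + j) := pow_pos hN0 _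
      have hle : (N : ℝ) ^ J ≤ (N : ℝ) ^ (J + j) := pow_le_pow_right₀ hN1.le (by omega)
      have h1 := hξ.2.1
      have h2 := hξ.2.2
      constructor
      · rw [lt_div_iff₀ hp]; linarith
      · rw [div_le_iff₀ hp]; linarith
    have hmono : ∀ j : ℕ, ∀ᵐ ξ ∂volume.restrict B, G (J + j) ξ ≤ G (J + j.succ) ξ := fun j => by
      refine ae_le_of_forall_setLIntegral_le_of_sigmaFinite (hGm _) fun s hs _ => ?_
      rw [hint s hs, hint s hs]
      refine ENNReal.ofReal_le_ofReal (sub_le_sub_left (pow_le_pow_left₀ Metric.infDist_nonneg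
        (hV.antitone_infDist _ (by exact_mod_cast (by omega : J + j ≤ J + j.succ))) 2) _)
    -- By monotone convergence the supremum has integral `|s ∩ B|` over every measurable `s`, since
    -- the distances tend to zero.
    have hsup : ∀ᵐ ξ ∂volume.restrict B, ⨆ j : ℕ, G (J + j) ξ = 1 := by
      refine ae_eq_of_forall_setLIntegral_eq_of_sigmaFinite (g := fun _ => 1)
        (Measurable.iSup fun j => hGm _) measurable_const fun s hs _ => ?_
      rw [lintegral_iSup_ae (fun j => hGm _) (fun j => ae_restrict_of_ae (hmono j)),
        setLIntegral_one, Measure.restrict_apply hs]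
      refine iSup_eq_of_tendsto ?_ ?_
      · refine monotone_nat_of_le_succ fun j => ?_
        exact lintegral_mono_ae (ae_restrict_of_ae (hmono j))
      · simp only [hint s hs]
        have h1 := (hV.tendsto_infDist (indicatorVec i (hs.inter hBm) (hfin s))).comp
          (tendsto_add_atTop_nat J)
        have h2 := ENNReal.tendsto_ofReal ((h1.pow 2).const_sub (volume (s ∩ B)).toReal)
        rw [zero_pow two_ne_zero, sub_zero, ENNReal.ofReal_toReal (hfin s)] at h2
        refine h2.congr fun j => ?_
        simp only [Function.comp_apply, add_comm j J]
    filter_upwards [ae_all_iff.2 hmono, hsup] with ξ h1 h2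
    have h3 := tendsto_atTop_iSup (f := fun j => G (J + j) ξ) (monotone_nat_of_le_succ h1)
    rw [h2] at h3
    rw [← tendsto_add_atTop_iff_nat J]
    simpa only [add_comm] using h3
  filter_upwards [ae_all_iff.2 hJ] with ξ hξ
  obtain ⟨J, hJ⟩ := ((tendsto_pow_atTop_atTop_of_one_lt hN1).eventually_gt_atTop (2 * |ξ|)).exists
  exact hξ J ⟨by linarith [neg_abs_le ξ], by linarith [le_abs_self ξ]⟩

theorem tendsto_localTrace (hV : IsGMRA N hN σ z V) (hΦ : IsNTFGenerator z Φ (V 0)) :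
    ∀ᵐ ξ : ℝ, ∀ i : Fin n, Tendsto (fun j : ℕ =>
      localTrace Φ i (ξ / (N : ℝ) ^ j)) atTop (𝓝 1) := by
  filter_upwards [ae_all_iff.2 (tendsto_localTrace_perm hV hΦ)] with ξ hξ i
  rw [tendsto_def]
  intro s hs
  -- Finitely many components give one threshold valid for all starting indices; the index `σ^j i`,
  -- which varies with `j`, then lands on component `i`.
  filter_upwards [eventually_all.2 fun k => (hξ k).eventually hs] with j hj
  have h := hj ((σ ^ j) i)
  rw [Equiv.symm_apply_apply] at h
  exact h

end SuperWavelet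

end

/-! ### Return to the normalization of `hat` and to real-valued sums. -/

theorem mainTheorem11 (n N : ℕ) (hN : 2 ≤ N) (σ : Equiv.Perm (Fin n)) (z : Fin n → Circle)
    (hz : ∀ i, z i ^ N = z (σ i))
    (V : ℤ → Submodule ℂ (SuperWavelet.L2Rn n)) (hV : SuperWavelet.IsGMRA N hN σ z V)
    (Φ : Set (SuperWavelet.L2Rn n)) (hΦ : SuperWavelet.IsNTFGenerator z Φ (V 0)) :
    ∀ᵐ ξ : ℝ, ∀ i : Fin n,
      (∀ m : ℕ, Summable fun φ : Φ =>
        ‖SuperWavelet.hat ((φ : SuperWavelet.L2Rn n) i) (ξ / (N : ℝ) ^ m)‖ ^ 2) ∧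
      Tendsto (fun m : ℕ => ∑' φ : Φ,
        ‖SuperWavelet.hat ((φ : SuperWavelet.L2Rn n) i) (ξ / (N : ℝ) ^ m)‖ ^ 2)
        atTop (𝓝 1) := by
  have hN0 : (0 : ℝ) < N := by exact_mod_cast (by omega : 0 < N)
  have hpi : (0 : ℝ) < 2 * Real.pi := by positivity
  have hle : ∀ (i : Fin n) (m : ℕ), ∀ᵐ ξ : ℝ,
      SuperWavelet.localTrace Φ i (ξ / (N : ℝ) ^ m / (2 * Real.pi)) ≤ 1 := fun i m =>
    (SuperWavelet.quasiMP_div (pow_pos hN0 m)).ae ((SuperWavelet.quasiMP_div hpi).ae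
      (SuperWavelet.localTrace_le_one hV hΦ i))
  -- Dilations preserve null sets, so the a.e. statements may be evaluated at `ξ / (2π)` and, for
  -- the bound, at all countably many scales at once.
  filter_upwards [ae_all_iff.2 fun i => ae_all_iff.2 (hle i),
    (SuperWavelet.quasiMP_div hpi).ae (SuperWavelet.tendsto_localTrace hV hΦ)] with ξ h1 h2 i
  have h3 : ∀ m : ℕ, SuperWavelet.localTrace Φ i (ξ / (N : ℝ) ^ m / (2 * Real.pi)) =
      ∑' φ : Φ, ENNReal.ofReal
        (‖SuperWavelet.hat ((φ : SuperWavelet.L2Rn n) i) (ξ / (N : ℝ) ^ m)‖ ^ 2) := fun m => by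
    simp only [ENNReal.ofReal_pow (norm_nonneg _), ofReal_norm]
    rfl
  have h4 : ∀ m : ℕ, Summable fun φ : Φ =>
      ‖SuperWavelet.hat ((φ : SuperWavelet.L2Rn n) i) (ξ / (N : ℝ) ^ m)‖ ^ 2 := fun m => by
    have h5 := ENNReal.summable_toReal (((h3 m).symm.trans_le (h1 i m)).trans_lt ENNReal.one_lt_top).ne
    simpa only [ENNReal.toReal_ofReal (sq_nonneg _)] using h5
  refine ⟨h4, ?_⟩
  have h5 := (ENNReal.tendsto_toReal ENNReal.one_ne_top).comp (h2 i)
  rw [ENNReal.toReal_one] at h5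
  refine h5.congr fun m => ?_
  rw [Function.comp_apply, div_right_comm, h3 m,
    ← ENNReal.ofReal_tsum_of_nonneg (fun φ => sq_nonneg _) (h4 m),
    ENNReal.toReal_ofReal (tsum_nonneg fun φ => sq_nonneg _)]
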